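/- Let $\mathfrak B$ be a $C^*$-algebra and $\mathfrak D\subset\mathfrak B$ a $C^*$-subalgebra. Let $\mathfrak A_1,\mathfrak A_2$ be complex $*$-algebras, each containing $\mathfrak B$ as a $*$-subalgebra. A linear map $E$ from a $*$-algebra onto a $*$-subalgebra $\mathfrak C$ is called a conditional expectation if $E(c)=c$, $E(ca)=cE(a)$ and $E(ac)=E(a)c$ for all $c\in\mathfrak C$ and all $a$; a linear map $E$ into a $C^*$-algebra is called positive if $E(a^*a)\ge 0$ for all $a$. Suppose that each $\mathfrak A_j$ ($j=1,2$) is endowed with two positive conditional expectations $\Phi_j:\mathfrak A_j\to\mathfrak B$ and $\Psi_j:\mathfrak A_j\to\mathfrak D$. Let $(\mathfrak A,\Phi,\Psi)$ be the conditionally free (c-free) product with amalgamation over $(\mathfrak B,\mathfrak D)$ of the triples $(\mathfrak A_j,\Phi_j,\Psi_j)$, $j=1,2$; that is, $\mathfrak A=\mathfrak A_1 *_{\mathfrak B}\mathfrak A_2$ is the free product of the $*$-algebras $\mathfrak A_1,\mathfrak A_2$ with amalgamation over $\mathfrak B$, and $\Phi:\mathfrak A\to\mathfrak B$, $\Psi:\mathfrak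 A\to\mathfrak D$ are conditional expectations such that $$\Psi(a_1a_2\cdots a_n)=0,\qquad \Phi(a_1a_2\cdots a_n)=\Phi_{\varepsilon(1)}(a_1)\,\Phi_{\varepsilon(2)}(a_2)\cdots\Phi_{\varepsilon(n)}(a_n)$$ for all $n\ge 1$, all $\varepsilon(1),\dots,\varepsilon(n)\in\{1,2\}$ with $\varepsilon(i)\neq\varepsilon(i+1)$ for $1\le i<n$, and all $a_i\in\mathfrak A_{\varepsilon(i)}$ with $\Psi_{\varepsilon(i)}(a_i)=0$. Then both maps $\Phi$ and $\Psi$ are positive: $\Phi(a^*a)\ge 0$ in $\mathfrak B$ and $\Psi(a^*a)\ge 0$ in $\mathfrak D$ for every $a\in\mathfrak A$. -/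

import Mathlib

/-- The product `a₁ a₂ ⋯ aₙ` (`n ≥ 1`) of the nonempty word with first letter `a₁` and list of
remaining letters `[a₂, …, aₙ]`; no unit is needed. -/
def wordProd {M : Type*} [Mul M] : M → List M → M
  | a, [] => a
  | a, b :: l => a * wordProd b l

/-- A linear map `E : A → C` is a conditional expectation onto `C`, where `C` is regarded as a
subalgebra of `A` through `γ`: it is the identity on `C`, and it is a `C`-bimodule map. -/
structure IsCondExp {A C : Type*} [NonUnitalRing A] [StarRing A] [Module ℂ A]
    [NonUnitalRing C] [StarRing C] [Module ℂ C] (γ : C →⋆ₙₐ[ℂ] A) (E : A →ₗ[ℂ] C) : Prop where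
  apply_self : ∀ c : C, E (γ c) = c
  mul_left : ∀ (c : C) (a : A), E (γ c * a) = c * E a
  mul_right : ∀ (a : A) (c : C), E (a * γ c) = E a * c

/-- A linear map from a `*`-algebra to a C*-algebra is positive if it maps every `a* a` to a
positive element. -/
def IsPositiveMap {A C : Type*} [NonUnitalRing A] [StarRing A] [Module ℂ A]
    [NonUnitalCStarAlgebra C] [PartialOrder C] (E : A →ₗ[ℂ] C) : Prop :=
  ∀ a : A, 0 ≤ E (star a * a)

section FreeProduct

universe u v w

variable {J : Type w} {B : Type v} {A : J → Type u}

/-- Formal expressions in the elements of the algebras `A j`. -/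
inductive FreeTerm (A : J → Type u) : Type (max u w)
  | of (j : J) (a : A j) : FreeTerm A
  | zero : FreeTerm A
  | add (x y : FreeTerm A) : FreeTerm A
  | neg (x : FreeTerm A) : FreeTerm A
  | smul (c : ℂ) (x : FreeTerm A) : FreeTerm A
  | mul (x y : FreeTerm A) : FreeTerm A

namespace FreeTerm

/-- The involution on formal expressions: conjugate-linear, order-reversing, and equal to the given
involution on each `A j`. -/
def conj [∀ j, Star (A j)] : FreeTerm A → FreeTerm A
  | of j a => of j (star a)
  | zero => zero
  | add x y => add x.conj y.conj
  | neg x => neg x.conj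
  | smul c x => smul (star c) x.conj
  | mul x y => mul y.conj x.conj

theorem conj_conj [∀ j, InvolutiveStar (A j)] (x : FreeTerm A) : x.conj.conj = x := by
  induction x <;> simp_all [conj]

end FreeTerm

variable [NonUnitalRing B] [StarRing B] [Module ℂ B]
  [∀ j, NonUnitalRing (A j)] [∀ j, StarRing (A j)] [∀ j, Module ℂ (A j)]

open FreeTerm in
/-- The smallest congruence on formal expressions that makes them an associative complex algebra,
makes every `of j` an algebra homomorphism, and identifies, for each `b` in `B`, all the copies
`β j b` of `b`. -/
inductive AmalgRel (β : ∀ j, B →⋆ₙₐ[ℂ] A j) : FreeTerm A → FreeTerm A → Prop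
  -- congruence
  | refl (x) : AmalgRel β x x
  | symm {x y} : AmalgRel β x y → AmalgRel β y x
  | trans {x y z} : AmalgRel β x y → AmalgRel β y z → AmalgRel β x z
  | add_congr {x x' y y'} : AmalgRel β x x' → AmalgRel β y y' → AmalgRel β (add x y) (add x' y')
  | neg_congr {x x'} : AmalgRel β x x' → AmalgRel β (neg x) (neg x')
  | smul_congr (c) {x x'} : AmalgRel β x x' → AmalgRel β (smul c x) (smul c x')
  | mul_congr {x x' y y'} : AmalgRel β x x' → AmalgRel β y y' → AmalgRel β (mul x y) (mul x' y')
  -- the laws of an associative algebra over `ℂ`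
  | add_assoc (x y z) : AmalgRel β (add (add x y) z) (add x (add y z))
  | add_comm (x y) : AmalgRel β (add x y) (add y x)
  | zero_add (x) : AmalgRel β (add zero x) x
  | neg_add_cancel (x) : AmalgRel β (add (neg x) x) zero
  | one_smul (x) : AmalgRel β (smul 1 x) x
  | mul_smul (c d x) : AmalgRel β (smul (c * d) x) (smul c (smul d x))
  | smul_add (c x y) : AmalgRel β (smul c (add x y)) (add (smul c x) (smul c y))
  | add_smul (c d x) : AmalgRel β (smul (c + d) x) (add (smul c x) (smul d x))
  | mul_assoc (x y z) : AmalgRel β (mul (mul x y) z) (mul x (mul y z))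
  | left_distrib (x y z) : AmalgRel β (mul x (add y z)) (add (mul x y) (mul x z))
  | right_distrib (x y z) : AmalgRel β (mul (add x y) z) (add (mul x z) (mul y z))
  | smul_mul (c x y) : AmalgRel β (mul (smul c x) y) (smul c (mul x y))
  | mul_smul_comm (c x y) : AmalgRel β (mul x (smul c y)) (smul c (mul x y))
  -- the algebra structure of the `A j`, and the amalgamation
  | of_add (j) (a b : A j) : AmalgRel β (of j (a + b)) (add (of j a) (of j b))
  | of_smul (j) (c : ℂ) (a : A j) : AmalgRel β (of j (c • a)) (smul c (of j a))
  | of_mul (j) (a b : A j) : AmalgRel β (of j (a * b)) (mul (of j a) (of j b))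
  | amalg (j k) (b : B) : AmalgRel β (of j (β j b)) (of k (β k b))

/-- The free product of the algebras `A j` with amalgamation over `B`, where `B` is regarded as a
subalgebra of each `A j` through `β j`. -/
def AmalgFreeProduct (β : ∀ j, B →⋆ₙₐ[ℂ] A j) : Type (max u w) :=
  Quot (AmalgRel β)

namespace AmalgFreeProduct

variable (β : ∀ j, B →⋆ₙₐ[ℂ] A j)

instance : Zero (AmalgFreeProduct β) := ⟨Quot.mk _ .zero⟩

instance : Add (AmalgFreeProduct β) :=
  ⟨Quot.map₂ .add (fun _ _ _ h => .add_congr (.refl _) h) (fun _ _ _ h => .add_congr h (.refl _))⟩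

instance : Neg (AmalgFreeProduct β) := ⟨Quot.map .neg (fun _ _ h => .neg_congr h)⟩

instance : SMul ℂ (AmalgFreeProduct β) :=
  ⟨fun c => Quot.map (.smul c) (fun _ _ h => .smul_congr c h)⟩

instance : Mul (AmalgFreeProduct β) :=
  ⟨Quot.map₂ .mul (fun _ _ _ h => .mul_congr (.refl _) h) (fun _ _ _ h => .mul_congr h (.refl _))⟩

instance : AddCommGroup (AmalgFreeProduct β) :=
  { AddGroup.ofLeftAxioms
      (by rintro ⟨x⟩ ⟨y⟩ ⟨z⟩; exact Quot.sound (.add_assoc x y z))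
      (by rintro ⟨x⟩; exact Quot.sound (.zero_add x))
      (by rintro ⟨x⟩; exact Quot.sound (.neg_add_cancel x)) with
    add_comm := by rintro ⟨x⟩ ⟨y⟩; exact Quot.sound (.add_comm x y) }

instance : NonUnitalRing (AmalgFreeProduct β) :=
  have hl : ∀ x y z : AmalgFreeProduct β, x * (y + z) = x * y + x * z := by
    rintro ⟨x⟩ ⟨y⟩ ⟨z⟩; exact Quot.sound (.left_distrib x y z)
  have hr : ∀ x y z : AmalgFreeProduct β, (x + y) * z = x * z + y * z := by
    rintro ⟨x⟩ ⟨y⟩ ⟨z⟩; exact Quot.sound (.right_distrib x y z)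
  { (inferInstance : AddCommGroup (AmalgFreeProduct β)),
    (inferInstance : Mul (AmalgFreeProduct β)) with
    left_distrib := hl
    right_distrib := hr
    zero_mul := fun x => by simpa using hr 0 0 x
    mul_zero := fun x => by simpa using hl x 0 0
    mul_assoc := by rintro ⟨x⟩ ⟨y⟩ ⟨z⟩; exact Quot.sound (.mul_assoc x y z) }

instance : Module ℂ (AmalgFreeProduct β) :=
  .ofMinimalAxioms
    (by rintro c ⟨x⟩ ⟨y⟩; exact Quot.sound (.smul_add c x y))
    (by rintro c d ⟨x⟩; exact Quot.sound (.add_smul c d x))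
    (by rintro c d ⟨x⟩; exact Quot.sound (.mul_smul c d x))
    (by rintro ⟨x⟩; exact Quot.sound (.one_smul x))

instance : IsScalarTower ℂ (AmalgFreeProduct β) (AmalgFreeProduct β) :=
  ⟨by rintro c ⟨x⟩ ⟨y⟩; exact Quot.sound (.smul_mul c x y)⟩

instance : SMulCommClass ℂ (AmalgFreeProduct β) (AmalgFreeProduct β) :=
  ⟨by rintro c ⟨x⟩ ⟨y⟩; exact (Quot.sound (.mul_smul_comm c x y)).symm⟩

theorem conj_rel [∀ j, StarModule ℂ (A j)] {x y : FreeTerm A} (h : AmalgRel β x y) :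
    AmalgRel β x.conj y.conj := by
  induction h with
  | refl x => exact .refl _
  | symm _ ih => exact .symm ih
  | trans _ _ ih₁ ih₂ => exact .trans ih₁ ih₂
  | add_congr _ _ ih₁ ih₂ => exact .add_congr ih₁ ih₂
  | neg_congr _ ih => exact .neg_congr ih
  | smul_congr c _ ih => exact .smul_congr _ ih
  | mul_congr _ _ ih₁ ih₂ => exact .mul_congr ih₂ ih₁
  | add_assoc x y z => exact .add_assoc _ _ _
  | add_comm x y => exact .add_comm _ _
  | zero_add x => exact .zero_add _
  | neg_add_cancel x => exact .neg_add_cancel _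
  | one_smul x => simpa [FreeTerm.conj] using AmalgRel.one_smul (β := β) x.conj
  | mul_smul c d x => simpa [FreeTerm.conj] using AmalgRel.mul_smul (β := β) _ _ x.conj
  | smul_add c x y => exact .smul_add _ _ _
  | add_smul c d x => simpa [FreeTerm.conj] using AmalgRel.add_smul (β := β) _ _ x.conj
  | mul_assoc x y z => exact .symm (.mul_assoc _ _ _)
  | left_distrib x y z => exact .right_distrib _ _ _
  | right_distrib x y z => exact .left_distrib _ _ _
  | smul_mul c x y => exact .mul_smul_comm _ _ _
  | mul_smul_comm c x y => exact .smul_mul _ _ _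
  | of_add j a b => simpa [FreeTerm.conj] using AmalgRel.of_add (β := β) j (star a) (star b)
  | of_smul j c a => simpa [FreeTerm.conj] using AmalgRel.of_smul (β := β) j (star c) (star a)
  | of_mul j a b => simpa [FreeTerm.conj] using AmalgRel.of_mul (β := β) j (star b) (star a)
  | amalg j k b =>
    have h := AmalgRel.amalg (β := β) j k (star b)
    rw [map_star, map_star] at h
    exact h

instance [∀ j, StarModule ℂ (A j)] : StarRing (AmalgFreeProduct β) where
  star := Quot.map FreeTerm.conj (fun _ _ h => conj_rel β h)
  star_involutive := by rintro ⟨x⟩; exact congrArg (Quot.mk (AmalgRel β)) (FreeTerm.conj_conj x)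
  star_mul := by rintro ⟨x⟩ ⟨y⟩; rfl
  star_add := by rintro ⟨x⟩ ⟨y⟩; rfl

instance [∀ j, StarModule ℂ (A j)] : StarModule ℂ (AmalgFreeProduct β) :=
  ⟨by rintro c ⟨x⟩; rfl⟩

/-- The canonical `*`-homomorphism from `A j` to the free product. -/
def of [∀ j, StarModule ℂ (A j)] (j : J) : A j →⋆ₙₐ[ℂ] AmalgFreeProduct β where
  toFun a := Quot.mk _ (.of j a)
  map_smul' c a := Quot.sound (.of_smul j c a)
  map_zero' := by
    let z : AmalgFreeProduct β := Quot.mk _ (FreeTerm.of j 0)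
    have h : Quot.mk (AmalgRel β) (FreeTerm.of j (0 + 0)) = z + z :=
      Quot.sound (.of_add j 0 0)
    rw [add_zero] at h
    exact left_eq_add.mp h
  map_add' a b := Quot.sound (.of_add j a b)
  map_mul' a b := Quot.sound (.of_mul j a b)
  map_star' _ := rfl

theorem of_amalg [∀ j, StarModule ℂ (A j)] (j k : J) (b : B) :
    of β j (β j b) = of β k (β k b) :=
  Quot.sound (.amalg j k b)

end AmalgFreeProduct

end FreeProduct

/-- `(Φ, Ψ)` are the maps of the conditionally free product, with amalgamation over `(B, D)`, of the
triples `(A j, Φ' j, Ψ' j)`. Here `D ⊆ B` through `δ` and `B ⊆ A j` through `β j`; the underlying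
algebra is the free product with amalgamation over `B`. The words run over all lengths `n ≥ 1`, with
letters `aᵢ ∈ A (ε i)` such that consecutive indices `ε i` differ and every `aᵢ` lies in the kernel
of `Ψ' (ε i)`. The case `n = 1`, together with the values on `D`, says that `Φ` and `Ψ`
extend the `Φ' j` and the `Ψ' j`. -/
structure IsCFreeProduct {J : Type*} {D B : Type*} {A : J → Type*}
    [NonUnitalRing D] [StarRing D] [Module ℂ D] [NonUnitalRing B] [StarRing B] [Module ℂ B]
    [∀ j, NonUnitalRing (A j)] [∀ j, StarRing (A j)] [∀ j, Module ℂ (A j)]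
    [∀ j, StarModule ℂ (A j)]
    (δ : D →⋆ₙₐ[ℂ] B) (β : ∀ j, B →⋆ₙₐ[ℂ] A j)
    (Φ' : ∀ j, A j →ₗ[ℂ] B) (Ψ' : ∀ j, A j →ₗ[ℂ] D)
    (Φ : AmalgFreeProduct β →ₗ[ℂ] B) (Ψ : AmalgFreeProduct β →ₗ[ℂ] D) : Prop where
  condExp_left : ∀ j, IsCondExp ((AmalgFreeProduct.of β j).comp (β j)) Φ
  condExp_right : ∀ j, IsCondExp ((AmalgFreeProduct.of β j).comp ((β j).comp δ)) Ψ
  right_word : ∀ (x : Σ j, A j) (l : List (Σ j, A j)),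
    (x :: l).IsChain (fun y z => y.1 ≠ z.1) → (∀ y ∈ x :: l, Ψ' y.1 y.2 = 0) →
    Ψ (wordProd (AmalgFreeProduct.of β x.1 x.2)
      (l.map fun y => AmalgFreeProduct.of β y.1 y.2)) = 0
  left_word : ∀ (x : Σ j, A j) (l : List (Σ j, A j)),
    (x :: l).IsChain (fun y z => y.1 ≠ z.1) → (∀ y ∈ x :: l, Ψ' y.1 y.2 = 0) →
    Φ (wordProd (AmalgFreeProduct.of β x.1 x.2)
      (l.map fun y => AmalgFreeProduct.of β y.1 y.2))
      = wordProd (Φ' x.1 x.2) (l.map fun y => Φ' y.1 y.2)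

/-!
Both assertions are instances of one fact, `IsCFreeExtension.isPositiveMap`, about a map `Φ` on any
`*`-algebra `P` generated by images of the `A j`: if `Φ` of an alternating word with letters in the
kernels of the `Ψ' j` is the product of the `Φ' j` of the letters, then `Φ` satisfies the Schwarz
inequality `Φ(x)* Φ(x) ≤ Φ(x* x)`. Taking `B = D` and `Φ' = Ψ'` gives the positivity of `Ψ`. No
normal form in the free product is needed: it is enough that centered words and `D` span `P`.

The proof studies the covariance `K(x, y) = Φ(x* y) - Φ(x)* Φ(y)`. It vanishes if `x` or `y` lies in
`B`, and on pairs of centered words that begin in different `A j`. For words `a s` and `a' t` that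
begin in the same `A j`, splitting `a* a'` into a centered part and `Ψ'(a* a') ∈ D` gives
`K(a s, a' t) = Φ(s)* (Φ'(a* a') - Φ'(a)* Φ'(a')) Φ(t) + K(s, Ψ'(a* a') t)`
(`covariance_cons`). The first term is a positive kernel because the covariance of a positive
conditional expectation `E` is `E((a - E a)* (a' - E a'))`. For the second, `Ψ'` is completely
positive, as every positive conditional expectation is, so the matrix `Ψ'(aᵢ* aₖ)` factors as `y* y`
over `D` (`IsCondExp.exists_gram`), and the second term becomes a sum of values `K(z, z)` for sums
`z` of shorter words. Induction on the length of the words yields `K(z, z) ≥ 0`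
(`covariance_sum_wordVal_mem_nonnegInr`).

The algebras need not have units, while the computation needs the empty word; products of words are
therefore formed in the unitizations, and positivity is only ever asserted for elements of `B`.
-/

set_option linter.unusedSectionVars false

/-! ### Positive matrices over a C*-algebra and positive conditional expectations -/

/-- The decomposition of a self-adjoint element of a C*-algebra into its positive and negative parts,
with the negative part in factored form. -/
theorem IsSelfAdjoint.exists_sub_star_mul_self {R : Type*} [NonUnitalCStarAlgebra R]
    [PartialOrder R] [StarOrderedRing R] {M : R} (hM : IsSelfAdjoint M) :
    ∃ y s : R, M = star y * y - star s * s ∧ (star s * s) * (star y * y) = 0 := by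
  obtain ⟨y, hy⟩ := CStarAlgebra.nonneg_iff_eq_star_mul_self.mp (CFC.posPart_nonneg M)
  obtain ⟨s, hs⟩ := CStarAlgebra.nonneg_iff_eq_star_mul_self.mp (CFC.negPart_nonneg M)
  refine ⟨y, s, ?_, ?_⟩
  · rw [← hy, ← hs, CFC.posPart_sub_negPart M hM]
  · rw [← hy, ← hs, CFC.negPart_mul_posPart]

/-- A matrix `m` over a C*-algebra with `∑ dᵢ* mᵢₖ dₖ ≥ 0` for all `d` is positive in the C*-algebra
of matrices, and so is of the form `y* y`. -/
theorem exists_eq_sum_star_mul {D ι : Type*} [Fintype ι]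
    [NonUnitalCStarAlgebra D] [PartialOrder D] [StarOrderedRing D] (m : ι → ι → D)
    (hm : ∀ i k, star (m i k) = m k i)
    (hpos : ∀ d : ι → D, 0 ≤ ∑ i, ∑ k, star (d i) * (m i k * d k)) :
    ∃ y : ι → ι → D, ∀ i k, m i k = ∑ l, star (y l i) * y l k := by
  classical
  set M : CStarMatrix ι ι D := CStarMatrix.ofMatrix m with hM
  have hMapp (i k : ι) : M i k = m i k := rfl
  have hMsa : IsSelfAdjoint M := by
    ext i k
    rw [CStarMatrix.star_apply, hMapp, hMapp, hm]
  obtain ⟨Y, S, hYS, hSY⟩ := hMsa.exists_sub_star_mul_self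
  set N := star S * S with hN
  have hNsa : star N = N := by simp [hN]
  -- `N M N = -N³`: its diagonal is nonnegative by hypothesis and nonpositive as `N³ ≥ 0`.
  have hNMN : star N * (M * N) = -(star (S * N) * (S * N)) := by
    calc star N * (M * N) = N * M * N := by rw [hNsa, ← mul_assoc]
      _ = -(N * N * N) := by rw [hYS, mul_sub, hSY, zero_sub, neg_mul]
      _ = -(star N * (star S * S) * N) := by rw [← hN, hNsa]
      _ = _ := by simp only [star_mul, mul_assoc]
  have hSN : S * N = 0 := by
    ext l c
    have hdiag := hpos fun i => N i c
    have he : ∑ i, ∑ k, star (N i c) * (m i k * N k c) = (star N * (M * N)) c c := by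
      simp [CStarMatrix.mul_apply, CStarMatrix.star_apply, hMapp, Finset.mul_sum]
    rw [he, hNMN, CStarMatrix.neg_apply, CStarMatrix.mul_apply] at hdiag
    simp only [CStarMatrix.star_apply] at hdiag
    have hz := le_antisymm (neg_nonneg.mp hdiag)
      (Finset.sum_nonneg fun i _ => star_mul_self_nonneg ((S * N) i c))
    rw [Finset.sum_eq_zero_iff_of_nonneg fun i _ => star_mul_self_nonneg ((S * N) i c)] at hz
    exact CStarRing.star_mul_self_eq_zero_iff _ |>.mp (hz l (Finset.mem_univ l))
  have hN0 : N = 0 := by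
    rw [← CStarRing.star_mul_self_eq_zero_iff, hNsa]
    nth_rw 1 [hN]
    rw [mul_assoc, hSN, mul_zero]
  rw [hN0, sub_zero] at hYS
  refine ⟨Y, fun i k => ?_⟩
  rw [← hMapp, hYS, CStarMatrix.mul_apply]
  simp only [CStarMatrix.star_apply]

namespace IsCondExp

variable {A C : Type*} [NonUnitalRing A] [StarRing A] [Module ℂ A]
  [IsScalarTower ℂ A A] [SMulCommClass ℂ A A] [StarModule ℂ A]
  [NonUnitalCStarAlgebra C] [PartialOrder C] [StarOrderedRing C]
  {γ : C →⋆ₙₐ[ℂ] A} {E : A →ₗ[ℂ] C}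

/-- Polarization gives `E (b* a) = E (a* b)*`; taking `b` in `C` yields the claim, without a unit. -/
theorem apply_star (hE : IsCondExp γ E) (hpos : IsPositiveMap E) (a : A) :
    E (star a) = star (E a) := by
  have hsa (a : A) : star (E (star a * a)) = E (star a * a) :=
    (IsSelfAdjoint.of_nonneg (hpos a)).star_eq
  have key (a b : A) : star (E (star a * b)) = E (star b * a) := by
    have h1 := hsa (a + b)
    have h2 := hsa (a + Complex.I • b)
    simp only [star_add, star_smul, add_mul, mul_add, smul_mul_assoc, mul_smul_comm, map_add,
      map_smul, hsa a, hsa b] at h1 h2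
    have h3 : star (E (star a * b)) + star (E (star b * a))
        = E (star a * b) + E (star b * a) := by
      linear_combination (norm := module) h1
    have h4 : -(Complex.I • star (E (star a * b))) + Complex.I • star (E (star b * a))
        = Complex.I • E (star a * b) - Complex.I • E (star b * a) := by
      simp only [RCLike.star_def, map_neg, Complex.conj_I, neg_neg] at h2
      linear_combination (norm := module) h2
    have h5 : -star (E (star a * b)) + star (E (star b * a))
        = E (star a * b) - E (star b * a) := by
      have := congrArg (fun x => (-Complex.I) • x) h4
      simpa [smul_add, smul_sub, smul_smul] using this
    have h6 : (2 : ℂ) • star (E (star a * b)) = (2 : ℂ) • E (star b * a) := by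
      rw [two_smul, two_smul]
      linear_combination (norm := module) h3 - h5
    exact smul_right_injective C (two_ne_zero' ℂ) h6
  have hc (c : C) : (E (star a) - star (E a)) * c = 0 := by
    have h := key (γ c) a
    rw [← StarHomClass.map_star γ, hE.mul_left, star_mul, star_star, hE.mul_right] at h
    rw [sub_mul, h, sub_self]
  rw [← sub_eq_zero]
  exact (CStarRing.mul_star_self_eq_zero_iff _).mp (hc _)

/-- A positive conditional expectation is completely positive: since `∑ dᵢ* E(aᵢ* aₖ) dₖ` equals
`E (x* x)` for `x = ∑ aᵢ dᵢ`, the matrix of the `E(aᵢ* aₖ)` factors as `y* y`. -/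
theorem exists_gram {ι : Type*} [Fintype ι] (hE : IsCondExp γ E) (hpos : IsPositiveMap E)
    (a : ι → A) : ∃ y : ι → ι → C, ∀ i k, E (star (a i) * a k) = ∑ l, star (y l i) * y l k := by
  refine exists_eq_sum_star_mul _ (fun i k => ?_) fun d => ?_
  · rw [← hE.apply_star hpos, star_mul, star_star]
  · have h := hpos (∑ i, a i * γ (d i))
    simp only [star_sum, Finset.sum_mul_sum, map_sum, star_mul, ← StarHomClass.map_star γ] at h
    convert h using 4 with i _ k _
    rw [mul_assoc, hE.mul_left, ← mul_assoc (star (a i)), hE.mul_right]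

end IsCondExp

/-! ### Extension of linear maps to the unitizations -/

open Unitization in
/-- The unital extension `λ + a ↦ λ + E a` of a linear map `E` to the unitizations. -/
def unitalExt {A C : Type*} [NonUnitalRing A] [Module ℂ A] [NonUnitalRing C] [Module ℂ C]
    (E : A →ₗ[ℂ] C) : Unitization ℂ A →ₗ[ℂ] Unitization ℂ C where
  toFun x := inl x.fst + inr (E x.snd)
  map_add' x y := by ext <;> simp
  map_smul' c x := by ext <;> simp

section UnitalExt

variable {A C : Type*} [NonUnitalRing A] [StarRing A] [Module ℂ A]
  [IsScalarTower ℂ A A] [SMulCommClass ℂ A A] [StarModule ℂ A]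
  [NonUnitalRing C] [StarRing C] [Module ℂ C]
  [IsScalarTower ℂ C C] [SMulCommClass ℂ C C] [StarModule ℂ C]
  {γ : C →⋆ₙₐ[ℂ] A} {E : A →ₗ[ℂ] C}

@[simp]
theorem unitalExt_fst (E : A →ₗ[ℂ] C) (x : Unitization ℂ A) : (unitalExt E x).fst = x.fst := by
  simp [unitalExt]

@[simp]
theorem unitalExt_snd (E : A →ₗ[ℂ] C) (x : Unitization ℂ A) :
    (unitalExt E x).snd = E x.snd := by
  simp [unitalExt]

@[simp]
theorem unitalExt_inr (E : A →ₗ[ℂ] C) (a : A) :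
    unitalExt E (a : Unitization ℂ A) = (E a : Unitization ℂ C) := by
  ext <;> simp

@[simp]
theorem unitalExt_one (E : A →ₗ[ℂ] C) : unitalExt E 1 = 1 := by
  ext <;> simp

theorem starMap_fst (γ : C →⋆ₙₐ[ℂ] A) (c : Unitization ℂ C) :
    (Unitization.starMap γ c).fst = c.fst := by
  induction c using Unitization.ind with | _ r c =>
    simp [Unitization.algebraMap_eq_inl]

theorem starMap_snd (γ : C →⋆ₙₐ[ℂ] A) (c : Unitization ℂ C) :
    (Unitization.starMap γ c).snd = γ c.snd := by
  induction c using Unitization.ind with | _ r c =>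
    simp [Unitization.algebraMap_eq_inl]

theorem IsCondExp.unitalExt_mul_left (hE : IsCondExp γ E) (c : Unitization ℂ C)
    (x : Unitization ℂ A) : unitalExt E (Unitization.starMap γ c * x) = c * unitalExt E x := by
  ext
  · rw [unitalExt_fst, Unitization.fst_mul, Unitization.fst_mul, starMap_fst, unitalExt_fst]
  · simp only [unitalExt_fst, unitalExt_snd, Unitization.snd_mul, starMap_fst, starMap_snd,
      map_add, map_smul, hE.apply_self, hE.mul_left]

theorem IsCondExp.unitalExt_mul_right (hE : IsCondExp γ E) (x : Unitization ℂ A)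
    (c : Unitization ℂ C) : unitalExt E (x * Unitization.starMap γ c) = unitalExt E x * c := by
  ext
  · rw [unitalExt_fst, Unitization.fst_mul, Unitization.fst_mul, starMap_fst, unitalExt_fst]
  · simp only [unitalExt_fst, unitalExt_snd, Unitization.snd_mul, starMap_fst, starMap_snd,
      map_add, map_smul, hE.apply_self, hE.mul_right]

theorem IsCondExp.unitalExt_starMap (hE : IsCondExp γ E) (c : Unitization ℂ C) :
    unitalExt E (Unitization.starMap γ c) = c := by
  simpa using hE.unitalExt_mul_right 1 c

end UnitalExt

theorem inr_wordProd {A : Type*} [NonUnitalRing A] [Module ℂ A]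
    [IsScalarTower ℂ A A] [SMulCommClass ℂ A A] (a : A) (l : List A) :
    Unitization.inr (R := ℂ) (wordProd a l) = (a : Unitization ℂ A) * (l.map Unitization.inr).prod := by
  induction l generalizing a with
  | nil => simp [wordProd]
  | cons b l ih => simp [wordProd, ih]

/-! ### Alternating centered words -/

section CFree

variable {J D B P : Type*} {A : J → Type*}
  [NonUnitalCStarAlgebra D] [PartialOrder D] [StarOrderedRing D]
  [NonUnitalCStarAlgebra B] [PartialOrder B] [StarOrderedRing B]
  [∀ j, NonUnitalRing (A j)] [∀ j, StarRing (A j)] [∀ j, Module ℂ (A j)]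
  [∀ j, IsScalarTower ℂ (A j) (A j)] [∀ j, SMulCommClass ℂ (A j) (A j)]
  [∀ j, StarModule ℂ (A j)]
  [NonUnitalRing P] [StarRing P] [Module ℂ P] [IsScalarTower ℂ P P] [SMulCommClass ℂ P P]
  [StarModule ℂ P]

/-- `Φ` is a conditionally free extension of the maps `Φ' j` to a `*`-algebra `P` generated by
images of the `A j`, with centering by the `Ψ' j`. The algebra `P` need not be an amalgamated free
product, and `D` may be equal to `B`; the case `Φ' = Ψ'` is freeness with amalgamation over `D`. -/
structure IsCFreeExtension (δ : D →⋆ₙₐ[ℂ] B) (β : ∀ j, B →⋆ₙₐ[ℂ] A j) (ι : ∀ j, A j →⋆ₙₐ[ℂ] P)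
    (κ : B →⋆ₙₐ[ℂ] P) (Φ' : ∀ j, A j →ₗ[ℂ] B) (Ψ' : ∀ j, A j →ₗ[ℂ] D) (Φ : P →ₗ[ℂ] B) :
    Prop where
  ι_β : ∀ j b, ι j (β j b) = κ b
  adjoin_eq_top : NonUnitalAlgebra.adjoin ℂ (⋃ j, Set.range (ι j)) = ⊤
  condExp_left' : ∀ j, IsCondExp (β j) (Φ' j)
  pos_left' : ∀ j, IsPositiveMap (Φ' j)
  condExp_right' : ∀ j, IsCondExp ((β j).comp δ) (Ψ' j)
  pos_right' : ∀ j, IsPositiveMap (Ψ' j)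
  condExp : IsCondExp κ Φ
  apply_word : ∀ (x : Σ j, A j) (l : List (Σ j, A j)),
    (x :: l).IsChain (fun y z => y.1 ≠ z.1) → (∀ y ∈ x :: l, Ψ' y.1 y.2 = 0) →
    Φ (wordProd (ι x.1 x.2) (l.map fun y => ι y.1 y.2))
      = wordProd (Φ' x.1 x.2) (l.map fun y => Φ' y.1 y.2)

/-- Alternating words (consecutive letters lie in different `A j`) whose letters are annihilated by
the `Ψ' j`; the empty word is allowed. -/
def IsCenteredWord (Ψ' : ∀ j, A j →ₗ[ℂ] D) (l : List (Σ j, A j)) : Prop :=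
  l.IsChain (fun y z => y.1 ≠ z.1) ∧ ∀ y ∈ l, Ψ' y.1 y.2 = 0

/-- The product in the unitization of `P` of the letters of a word. -/
def wordVal (ι : ∀ j, A j →⋆ₙₐ[ℂ] P) (l : List (Σ j, A j)) : Unitization ℂ P :=
  (l.map fun y => (ι y.1 y.2 : Unitization ℂ P)).prod

/-- The product in the unitization of `B` of the images of the letters of a word under the
`Φ' j`. -/
def wordExp (Φ' : ∀ j, A j →ₗ[ℂ] B) (l : List (Σ j, A j)) : Unitization ℂ B :=
  (l.map fun y => (Φ' y.1 y.2 : Unitization ℂ B)).prod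

/-- The adjoint word, with starred letters in reverse order. -/
def wordStar (l : List (Σ j, A j)) : List (Σ j, A j) :=
  (l.map fun y => (⟨y.1, star y.2⟩ : Σ j, A j)).reverse

variable {δ : D →⋆ₙₐ[ℂ] B} {β : ∀ j, B →⋆ₙₐ[ℂ] A j} {ι : ∀ j, A j →⋆ₙₐ[ℂ] P}
  {κ : B →⋆ₙₐ[ℂ] P} {Φ' : ∀ j, A j →ₗ[ℂ] B} {Ψ' : ∀ j, A j →ₗ[ℂ] D} {Φ : P →ₗ[ℂ] B}

@[simp]
theorem wordVal_nil : wordVal ι [] = 1 := rfl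

@[simp]
theorem wordVal_cons (x : Σ j, A j) (l : List (Σ j, A j)) :
    wordVal ι (x :: l) = (ι x.1 x.2 : Unitization ℂ P) * wordVal ι l := by
  simp [wordVal]

@[simp]
theorem wordVal_append (l l' : List (Σ j, A j)) :
    wordVal ι (l ++ l') = wordVal ι l * wordVal ι l' := by
  simp [wordVal]

@[simp]
theorem wordExp_nil : wordExp Φ' [] = 1 := rfl

@[simp]
theorem wordExp_cons (x : Σ j, A j) (l : List (Σ j, A j)) :
    wordExp Φ' (x :: l) = (Φ' x.1 x.2 : Unitization ℂ B) * wordExp Φ' l := by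
  simp [wordExp]

@[simp]
theorem wordExp_append (l l' : List (Σ j, A j)) :
    wordExp Φ' (l ++ l') = wordExp Φ' l * wordExp Φ' l' := by
  simp [wordExp]

theorem wordStar_cons (x : Σ j, A j) (l : List (Σ j, A j)) :
    wordStar (x :: l) = wordStar l ++ [⟨x.1, star x.2⟩] := by
  simp [wordStar]

@[simp]
theorem wordVal_wordStar (l : List (Σ j, A j)) : wordVal ι (wordStar l) = star (wordVal ι l) := by
  induction l with
  | nil => simp [wordStar]
  | cons x l ih => simp [wordStar_cons, ih, StarHomClass.map_star]

theorem isCenteredWord_nil : IsCenteredWord Ψ' [] := by simp [IsCenteredWord]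

theorem isCenteredWord_cons {x : Σ j, A j} {l : List (Σ j, A j)} :
    IsCenteredWord Ψ' (x :: l) ↔
      Ψ' x.1 x.2 = 0 ∧ IsCenteredWord Ψ' l ∧ ∀ y ∈ l.head?, x.1 ≠ y.1 := by
  simp only [IsCenteredWord, List.isChain_cons, List.forall_mem_cons]
  tauto

namespace IsCFreeExtension

variable (h : IsCFreeExtension δ β ι κ Φ' Ψ' Φ)
include h

theorem wordExp_wordStar (l : List (Σ j, A j)) :
    wordExp Φ' (wordStar l) = star (wordExp Φ' l) := by
  induction l with
  | nil => simp [wordStar]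
  | cons x l ih =>
    simp [wordStar_cons, ih, (h.condExp_left' x.1).apply_star (h.pos_left' x.1)]

theorem isCenteredWord_wordStar_append {s t : List (Σ j, A j)} (hs : IsCenteredWord Ψ' s)
    (ht : IsCenteredWord Ψ' t) (hst : ∀ x ∈ s.head?, ∀ y ∈ t.head?, x.1 ≠ y.1) :
    IsCenteredWord Ψ' (wordStar s ++ t) := by
  refine ⟨List.isChain_append.mpr ⟨?_, ht.1, ?_⟩, fun y hy => ?_⟩
  · rw [wordStar, List.isChain_reverse, List.isChain_map]
    exact hs.1.imp fun _ _ hne => hne.symm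
  · intro x hx y hy
    rw [wordStar, List.getLast?_reverse, List.head?_map, Option.mem_map] at hx
    obtain ⟨x, hx, rfl⟩ := hx
    exact hst x hx y hy
  · rcases List.mem_append.mp hy with hys | hys
    · simp only [wordStar, List.mem_reverse, List.mem_map] at hys
      obtain ⟨y, hys, rfl⟩ := hys
      simp [(h.condExp_right' y.1).apply_star (h.pos_right' y.1), hs.2 y hys]
    · exact ht.2 y hys

theorem unitalExt_wordVal {l : List (Σ j, A j)} (hl : IsCenteredWord Ψ' l) :
    unitalExt Φ (wordVal ι l) = wordExp Φ' l := by
  cases l with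
  | nil => simp
  | cons x l =>
    have hx : wordVal ι (x :: l)
        = Unitization.inr (wordProd (ι x.1 x.2) (l.map fun y => ι y.1 y.2)) := by
      simp [inr_wordProd, wordVal, Function.comp_def]
    rw [hx, unitalExt_inr, h.apply_word x l hl.1 hl.2, inr_wordProd]
    simp [wordExp, Function.comp_def]

end IsCFreeExtension

/-! ### The covariance form -/

/-- The covariance `Φ(x* y) - Φ(x)* Φ(y)` of `Φ`, on the unitizations. -/
def covariance (Φ : P →ₗ[ℂ] B) (x y : Unitization ℂ P) : Unitization ℂ B :=
  unitalExt Φ (star x * y) - star (unitalExt Φ x) * unitalExt Φ y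

theorem covariance_sum_left {α : Type*} (s : Finset α) (x : α → Unitization ℂ P)
    (y : Unitization ℂ P) : covariance Φ (∑ i ∈ s, x i) y = ∑ i ∈ s, covariance Φ (x i) y := by
  simp [covariance, Finset.sum_mul]

theorem covariance_sum_right {α : Type*} (s : Finset α) (x : Unitization ℂ P)
    (y : α → Unitization ℂ P) : covariance Φ x (∑ i ∈ s, y i) = ∑ i ∈ s, covariance Φ x (y i) := by
  simp [covariance, Finset.mul_sum]

theorem covariance_sum_sum {α : Type*} (s : Finset α) (x y : α → Unitization ℂ P) :
    covariance Φ (∑ i ∈ s, x i) (∑ k ∈ s, y k) = ∑ i ∈ s, ∑ k ∈ s, covariance Φ (x i) (y k) := by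
  rw [covariance_sum_left]
  exact Finset.sum_congr rfl fun i _ => covariance_sum_right _ _ _

theorem covariance_add_left (x x' y : Unitization ℂ P) :
    covariance Φ (x + x') y = covariance Φ x y + covariance Φ x' y := by
  simp only [covariance, star_add, add_mul, map_add]; abel

theorem covariance_add_right (x y y' : Unitization ℂ P) :
    covariance Φ x (y + y') = covariance Φ x y + covariance Φ x y' := by
  simp only [covariance, mul_add, map_add]; abel

theorem covariance_starMap_left (hΦ : IsCondExp κ Φ) (c : Unitization ℂ B)
    (y : Unitization ℂ P) : covariance Φ (Unitization.starMap κ c) y = 0 := by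
  rw [covariance, ← StarHomClass.map_star, hΦ.unitalExt_mul_left, hΦ.unitalExt_starMap, sub_self]

theorem covariance_starMap_right (hΦ : IsCondExp κ Φ) (x : Unitization ℂ P)
    (c : Unitization ℂ B) (hx : unitalExt Φ (star x) = star (unitalExt Φ x)) :
    covariance Φ x (Unitization.starMap κ c) = 0 := by
  rw [covariance, hΦ.unitalExt_mul_right, hΦ.unitalExt_starMap, hx, sub_self]

theorem covariance_starMap_mul (hΦ : IsCondExp κ Φ) (c : Unitization ℂ B)
    (x y : Unitization ℂ P) :
    covariance Φ (Unitization.starMap κ c * x) y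
      = covariance Φ x (Unitization.starMap κ (star c) * y) := by
  simp only [covariance, hΦ.unitalExt_mul_left, star_mul, ← StarHomClass.map_star, mul_assoc]

/-- The nonnegative elements of `B`, inside the unitization. -/
def nonnegInr (B : Type*) [NonUnitalCStarAlgebra B] [PartialOrder B] [StarOrderedRing B] :
    AddSubmonoid (Unitization ℂ B) where
  carrier := {z | ∃ b : B, 0 ≤ b ∧ z = Unitization.inr b}
  zero_mem' := ⟨0, le_rfl, by simp⟩
  add_mem' := by
    rintro _ _ ⟨b, hb, rfl⟩ ⟨c, hc, rfl⟩
    exact ⟨b + c, add_nonneg hb hc, by simp⟩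

/-- Complete positivity of the covariance of a positive conditional expectation, with coefficients
`q i` in the unitization: the sum is `E (z* z)` for `z = ∑ (aᵢ - E aᵢ) qᵢ`. -/
theorem IsCondExp.sum_covariance_mem_nonnegInr {A : Type*} [NonUnitalRing A] [StarRing A]
    [Module ℂ A] [IsScalarTower ℂ A A] [SMulCommClass ℂ A A] [StarModule ℂ A]
    {γ : B →⋆ₙₐ[ℂ] A} {E : A →ₗ[ℂ] B} (hE : IsCondExp γ E) (hpos : IsPositiveMap E)
    {α : Type*} [Fintype α] (a : α → A) (q : α → Unitization ℂ B) :
    ∑ i, ∑ k, star (q i) * covariance E (a i) (a k) * q k ∈ nonnegInr B := by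
  set z : Unitization ℂ A :=
    ∑ i, Unitization.inr (a i - γ (E (a i))) * Unitization.starMap γ (q i) with hz
  have hz0 : z = Unitization.inr z.snd := by
    ext
    · have : Unitization.fstHom ℂ A z = 0 := by
        rw [hz, map_sum]
        exact Finset.sum_eq_zero fun i _ => by
          rw [map_mul, Unitization.fstHom_apply, Unitization.fst_inr, zero_mul]
      simpa using this
    · simp
  refine ⟨E (star z.snd * z.snd), hpos _, ?_⟩
  rw [← unitalExt_inr, Unitization.inr_mul, Unitization.inr_star, ← hz0, hz]
  simp only [star_sum, Finset.sum_mul_sum, map_sum, star_mul, ← StarHomClass.map_star]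
  refine Finset.sum_congr rfl fun i _ => Finset.sum_congr rfl fun k _ => ?_
  rw [mul_assoc (Unitization.starMap γ (star (q i))), hE.unitalExt_mul_left, ← mul_assoc (star _),
    hE.unitalExt_mul_right, mul_assoc]
  congr 2
  rw [← Unitization.inr_star, ← Unitization.inr_mul, unitalExt_inr, covariance,
    ← Unitization.inr_star, ← Unitization.inr_mul, unitalExt_inr, unitalExt_inr, unitalExt_inr,
    ← Unitization.inr_star, ← Unitization.inr_mul, ← Unitization.inr_sub]
  congr 1
  simp only [star_sub, sub_mul, mul_sub, map_sub, ← StarHomClass.map_star, hE.mul_left, hE.mul_right,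
    hE.apply_star hpos, hE.apply_self]
  abel

namespace IsCFreeExtension

variable (h : IsCFreeExtension δ β ι κ Φ' Ψ' Φ)
include h

theorem covariance_wordVal_eq_zero {s t : List (Σ j, A j)} (hs : IsCenteredWord Ψ' s)
    (ht : IsCenteredWord Ψ' t) (hst : ∀ x ∈ s.head?, ∀ y ∈ t.head?, x.1 ≠ y.1) :
    covariance Φ (wordVal ι s) (wordVal ι t) = 0 := by
  rw [covariance, ← wordVal_wordStar, ← wordVal_append,
    h.unitalExt_wordVal (h.isCenteredWord_wordStar_append hs ht hst), h.unitalExt_wordVal hs,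
    h.unitalExt_wordVal ht, wordExp_append, h.wordExp_wordStar, sub_self]

/-- Peeling off the first letters of two words that begin in the same `A j`: split `a* a'` into a
centered part, which continues the alternating word, and its value `Ψ'(a* a')` in `D`. -/
theorem covariance_cons {j : J} {a a' : A j} {s t : List (Σ j, A j)}
    (has : IsCenteredWord Ψ' (⟨j, a⟩ :: s)) (hat : IsCenteredWord Ψ' (⟨j, a'⟩ :: t)) :
    covariance Φ (wordVal ι (⟨j, a⟩ :: s)) (wordVal ι (⟨j, a'⟩ :: t))
      = star (wordExp Φ' s) * covariance (Φ' j) a a' * wordExp Φ' t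
        + covariance Φ (wordVal ι s)
          (Unitization.starMap κ (δ (Ψ' j (star a * a')) : Unitization ℂ B) * wordVal ι t) := by
  obtain ⟨-, hs, hjs⟩ := isCenteredWord_cons.mp has
  obtain ⟨-, ht, hjt⟩ := isCenteredWord_cons.mp hat
  set d := Ψ' j (star a * a') with hd
  set c := star a * a' - β j (δ d) with hc
  have hc0 : Ψ' j c = 0 := by
    have := (h.condExp_right' j).apply_self d
    simp only [NonUnitalStarAlgHom.comp_apply] at this
    rw [hc, map_sub, this, ← hd, sub_self]
  have hword : IsCenteredWord Ψ' (wordStar s ++ ⟨j, c⟩ :: t) := by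
    refine h.isCenteredWord_wordStar_append hs (isCenteredWord_cons.mpr ⟨hc0, ht, hjt⟩) ?_
    intro x hx y hy
    simp only [List.head?_cons, Option.mem_some_iff] at hy
    subst hy
    exact (hjs x hx).symm
  have hval := h.unitalExt_wordVal hword
  rw [wordVal_append, wordExp_append, wordVal_wordStar, h.wordExp_wordStar, wordVal_cons,
    wordExp_cons] at hval
  have hΦc : Φ' j c = Φ' j (star a * a') - δ d := by
    rw [hc, map_sub, (h.condExp_left' j).apply_self]
  have hprod : star (wordVal ι (⟨j, a⟩ :: s)) * wordVal ι (⟨j, a'⟩ :: t)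
      = star (wordVal ι s) * (Unitization.inr (ι j c) * wordVal ι t)
        + star (wordVal ι s)
          * (Unitization.starMap κ (δ d : Unitization ℂ B) * wordVal ι t) := by
    rw [← mul_add, ← add_mul, Unitization.starMap_inr, ← Unitization.inr_add, hc, map_sub,
      h.ι_β, sub_add_cancel, map_mul, StarHomClass.map_star]
    simp [mul_assoc]
  have e1 : covariance (Φ' j) (a : Unitization ℂ (A j)) a'
      = (Φ' j c : Unitization ℂ B) + (δ d : Unitization ℂ B)
        - star (Φ' j a : Unitization ℂ B) * (Φ' j a' : Unitization ℂ B) := by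
    rw [covariance, ← Unitization.inr_star, ← Unitization.inr_mul, unitalExt_inr, unitalExt_inr,
      unitalExt_inr, ← Unitization.inr_add, hΦc, sub_add_cancel]
  rw [e1, covariance, hprod, map_add, hval, covariance, h.condExp.unitalExt_mul_left,
    h.unitalExt_wordVal has, h.unitalExt_wordVal hat, h.unitalExt_wordVal hs,
    h.unitalExt_wordVal ht, wordExp_cons, wordExp_cons, star_mul]
  noncomm_ring

end IsCFreeExtension

/-! ### Positivity of the covariance -/

/-- Multiplication of the first letter of a word by an element of `D` on the left; the empty word is
left alone. -/
def smulHead (δ : D →⋆ₙₐ[ℂ] B) (β : ∀ j, B →⋆ₙₐ[ℂ] A j) (d : D) :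
    List (Σ j, A j) → List (Σ j, A j)
  | [] => []
  | x :: l => ⟨x.1, β x.1 (δ d) * x.2⟩ :: l

@[simp]
theorem length_smulHead (d : D) (l : List (Σ j, A j)) :
    (smulHead δ β d l).length = l.length := by
  cases l <;> simp [smulHead]

namespace IsCFreeExtension

variable (h : IsCFreeExtension δ β ι κ Φ' Ψ' Φ)
include h

theorem isCenteredWord_smulHead (d : D) {l : List (Σ j, A j)} (hl : IsCenteredWord Ψ' l) :
    IsCenteredWord Ψ' (smulHead δ β d l) := by
  cases l with
  | nil => exact hl
  | cons x l =>
    obtain ⟨hx, hl, hne⟩ := isCenteredWord_cons.mp hl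
    refine isCenteredWord_cons.mpr ⟨?_, hl, hne⟩
    have := (h.condExp_right' x.1).mul_left d x.2
    simp only [NonUnitalStarAlgHom.comp_apply] at this
    rw [this, hx, mul_zero]

/-- The correction is `-1` times an element of `B`, and is present only for the empty word. -/
theorem exists_wordVal_smulHead (d : D) (l : List (Σ j, A j)) :
    ∃ c : Unitization ℂ B, Unitization.starMap κ (δ d : Unitization ℂ B) * wordVal ι l
      = wordVal ι (smulHead δ β d l) + Unitization.starMap κ c := by
  cases l with
  | nil => exact ⟨(δ d : Unitization ℂ B) - 1, by rw [map_sub, map_one]; simp [smulHead]⟩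
  | cons x l => exact ⟨0, by simp [smulHead, h.ι_β, mul_assoc]⟩

theorem covariance_sum_add_starMap {α : Type*} [Fintype α] (w : α → List (Σ j, A j))
    (hw : ∀ i, IsCenteredWord Ψ' (w i)) (c : Unitization ℂ B) :
    covariance Φ (∑ i, wordVal ι (w i) + Unitization.starMap κ c)
        (∑ i, wordVal ι (w i) + Unitization.starMap κ c)
      = covariance Φ (∑ i, wordVal ι (w i)) (∑ i, wordVal ι (w i)) := by
  have hstar : unitalExt Φ (star (∑ i, wordVal ι (w i)))
      = star (unitalExt Φ (∑ i, wordVal ι (w i))) := by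
    simp only [star_sum, map_sum]
    refine Finset.sum_congr rfl fun i _ => ?_
    have hs := h.isCenteredWord_wordStar_append (hw i) isCenteredWord_nil (by simp)
    rw [List.append_nil] at hs
    rw [← wordVal_wordStar, h.unitalExt_wordVal hs, h.unitalExt_wordVal (hw i),
      h.wordExp_wordStar]
  rw [covariance_add_left, covariance_add_right, covariance_starMap_left h.condExp,
    covariance_starMap_right h.condExp _ _ hstar, add_zero, add_zero]

/-- The induction step for sums of words that all begin in `A j`. The matrix `Ψ'(aᵢ* aₖ)` factors as
`y* y` over `D`, which turns the second term of `covariance_cons` into covariances of sums of the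
shorter words `y u`. -/
theorem covariance_cons_mem_nonnegInr {α : Type*} [Fintype α] (j : J) (a : α → A j)
    (u : α → List (Σ j, A j)) (hau : ∀ i, IsCenteredWord Ψ' (⟨j, a i⟩ :: u i))
    (ih : ∀ v : α → List (Σ j, A j), (∀ i, IsCenteredWord Ψ' (v i)) →
      (∀ i, (v i).length = (u i).length) →
      covariance Φ (∑ i, wordVal ι (v i)) (∑ i, wordVal ι (v i)) ∈ nonnegInr B) :
    covariance Φ (∑ i, wordVal ι (⟨j, a i⟩ :: u i)) (∑ i, wordVal ι (⟨j, a i⟩ :: u i))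
      ∈ nonnegInr B := by
  obtain ⟨y, hy⟩ := (h.condExp_right' j).exists_gram (h.pos_right' j) a
  have hu (i : α) : IsCenteredWord Ψ' (u i) := (isCenteredWord_cons.mp (hau i)).2.1
  have key (l : α) :
      covariance Φ (∑ i, Unitization.starMap κ (δ (y l i) : Unitization ℂ B) * wordVal ι (u i))
        (∑ i, Unitization.starMap κ (δ (y l i) : Unitization ℂ B) * wordVal ι (u i))
        ∈ nonnegInr B := by
    choose c hc using fun i => h.exists_wordVal_smulHead (y l i) (u i)
    simp only [hc, Finset.sum_add_distrib, ← map_sum (Unitization.starMap κ)]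
    rw [h.covariance_sum_add_starMap _ fun i => h.isCenteredWord_smulHead (y l i) (hu i)]
    exact ih _ (fun i => h.isCenteredWord_smulHead (y l i) (hu i)) fun i => length_smulHead _ _
  have hsum : covariance Φ (∑ i, wordVal ι (⟨j, a i⟩ :: u i)) (∑ i, wordVal ι (⟨j, a i⟩ :: u i))
      = (∑ i, ∑ k, star (wordExp Φ' (u i)) * covariance (Φ' j) (a i) (a k) * wordExp Φ' (u k))
        + ∑ l, covariance Φ
          (∑ i, Unitization.starMap κ (δ (y l i) : Unitization ℂ B) * wordVal ι (u i))
          (∑ i, Unitization.starMap κ (δ (y l i) : Unitization ℂ B) * wordVal ι (u i)) := by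
    simp only [covariance_sum_sum]
    refine Eq.trans ?_ (congrArg (_ + ·) Finset.sum_comm)
    rw [← Finset.sum_add_distrib]
    refine Finset.sum_congr rfl fun i _ => ?_
    rw [Finset.sum_comm, ← Finset.sum_add_distrib]
    refine Finset.sum_congr rfl fun k _ => ?_
    rw [h.covariance_cons (hau i) (hau k), hy]
    congr 1
    simp only [covariance_starMap_mul h.condExp, ← mul_assoc, ← map_mul (Unitization.starMap κ),
      ← Unitization.inr_star, ← Unitization.inr_mul, ← StarHomClass.map_star δ, ← map_mul δ]
    rw [← covariance_sum_right, ← Finset.sum_mul, ← map_sum, map_sum δ]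
    congr 3
    exact map_sum (Unitization.inrNonUnitalAlgHom ℂ B) _ _
  rw [hsum]
  exact add_mem ((h.condExp_left' j).sum_covariance_mem_nonnegInr (h.pos_left' j) _ _)
    (sum_mem fun l _ => key l)

/-- Words that begin in different `A j` are uncorrelated, as is the empty word with every word, so
that the words can be grouped by the index of their first letter. -/
theorem covariance_sum_wordVal_mem_nonnegInr [Fintype J] (n : ℕ) {α : Type} [Fintype α]
    (w : α → List (Σ j, A j)) (hw : ∀ i, IsCenteredWord Ψ' (w i)) (hn : ∀ i, (w i).length < n) :
    covariance Φ (∑ i, wordVal ι (w i)) (∑ i, wordVal ι (w i)) ∈ nonnegInr B := by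
  classical
  induction n generalizing α with
  | zero =>
    have : IsEmpty α := ⟨fun i => absurd (hn i) (Nat.not_lt_zero _)⟩
    simp [covariance]
  | succ n ih =>
    set g : α → Option J := fun i => (w i).head?.map Sigma.fst with hg
    have hsplit : covariance Φ (∑ i, wordVal ι (w i)) (∑ i, wordVal ι (w i))
        = ∑ o : Option J, covariance Φ (∑ i : {i // g i = o}, wordVal ι (w i))
          (∑ i : {i // g i = o}, wordVal ι (w i)) := by
      rw [← Fintype.sum_fiberwise g fun i => wordVal ι (w i), covariance_sum_left]
      refine Finset.sum_congr rfl fun o _ => ?_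
      rw [covariance_sum_right]
      refine Finset.sum_eq_single o (fun o' _ hne => ?_) fun ho => absurd (Finset.mem_univ o) ho
      simp only [covariance_sum_left, covariance_sum_right]
      refine Finset.sum_eq_zero fun i _ => Finset.sum_eq_zero fun k _ =>
        h.covariance_wordVal_eq_zero (hw _) (hw _) fun x hx y hy hxy => hne ?_
      have hgi : g i = some y.1 := Option.map_eq_some_iff.mpr ⟨y, hy, rfl⟩
      have hgk : g k = some x.1 := Option.map_eq_some_iff.mpr ⟨x, hx, rfl⟩
      rw [← i.2, ← k.2, hgi, hgk, hxy]
    rw [hsplit]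
    refine sum_mem fun o _ => ?_
    cases o with
    | none =>
      have hnil (i : {i // g i = none}) : w i = [] := by
        simpa [hg] using i.2
      have h1 : ∑ i : {i // g i = none}, wordVal ι (w i)
          = Unitization.starMap κ (∑ i : {i // g i = none}, 1) := by
        rw [map_sum]
        exact Finset.sum_congr rfl fun i _ => by rw [hnil, wordVal_nil, map_one]
      rw [h1, covariance_starMap_left h.condExp]
      exact zero_mem _
    | some j =>
      have hcons (i : {i // g i = some j}) :
          ∃ (a : A j) (u : List (Σ j, A j)), w i = ⟨j, a⟩ :: u := by
        obtain ⟨i, hi⟩ := i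
        simp only [hg, Option.map_eq_some_iff] at hi
        obtain ⟨⟨j', a⟩, hx, rfl⟩ := hi
        exact ⟨a, _, List.eq_cons_of_mem_head? hx⟩
      choose a u hau using hcons
      simp only [hau]
      refine h.covariance_cons_mem_nonnegInr j a u (fun i => hau i ▸ hw i) fun v hv hlen => ?_
      refine ih v hv fun i => ?_
      have := hn i
      rw [hau, List.length_cons] at this
      rw [hlen]
      omega

end IsCFreeExtension

/-! ### Spanning by centered words -/

/-- The span of the alternating centered words, the empty word included, and of `D`. -/
def centeredSpan (δ : D →⋆ₙₐ[ℂ] B) (ι : ∀ j, A j →⋆ₙₐ[ℂ] P) (κ : B →⋆ₙₐ[ℂ] P)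
    (Ψ' : ∀ j, A j →ₗ[ℂ] D) : Submodule ℂ (Unitization ℂ P) :=
  Submodule.span ℂ ({z | ∃ l, IsCenteredWord Ψ' l ∧ z = wordVal ι l}
    ∪ Set.range fun d : D => Unitization.inr (κ (δ d)))

theorem wordVal_mem_centeredSpan {l : List (Σ j, A j)} (hl : IsCenteredWord Ψ' l) :
    wordVal ι l ∈ centeredSpan δ ι κ Ψ' :=
  Submodule.subset_span (Or.inl ⟨l, hl, rfl⟩)

theorem inr_coe_mem_centeredSpan (d : D) :
    Unitization.inr (κ (δ d)) ∈ centeredSpan δ ι κ Ψ' :=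
  Submodule.subset_span (Or.inr ⟨d, rfl⟩)

/-- Stability of `centeredSpan` under left multiplication can be checked on generators. -/
theorem mul_mem_centeredSpan_of_generators {z : Unitization ℂ P}
    (hw : ∀ l, IsCenteredWord Ψ' l → z * wordVal ι l ∈ centeredSpan δ ι κ Ψ')
    (hd : ∀ d : D, z * Unitization.inr (κ (δ d)) ∈ centeredSpan δ ι κ Ψ')
    {y : Unitization ℂ P} (hy : y ∈ centeredSpan δ ι κ Ψ') :
    z * y ∈ centeredSpan δ ι κ Ψ' := by
  induction hy using Submodule.span_induction with
  | mem y hy =>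
    rcases hy with ⟨l, hl, rfl⟩ | ⟨d, rfl⟩
    exacts [hw l hl, hd d]
  | zero => simp
  | add y y' _ _ ih ih' => rw [mul_add]; exact add_mem ih ih'
  | smul c y _ ih => rw [mul_smul_comm]; exact Submodule.smul_mem _ c ih

namespace IsCFreeExtension

variable (h : IsCFreeExtension δ β ι κ Φ' Ψ' Φ)
include h

theorem inr_mul_mem_centeredSpan (d : D) {y : Unitization ℂ P}
    (hy : y ∈ centeredSpan δ ι κ Ψ') :
    Unitization.inr (κ (δ d)) * y ∈ centeredSpan δ ι κ Ψ' := by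
  refine mul_mem_centeredSpan_of_generators (fun l hl => ?_) (fun d' => ?_) hy
  · cases l with
    | nil => simpa using inr_coe_mem_centeredSpan d
    | cons x l =>
      have : Unitization.inr (κ (δ d)) * wordVal ι (x :: l)
          = wordVal ι (smulHead δ β d (x :: l)) := by
        simp [smulHead, h.ι_β, mul_assoc]
      rw [this]
      exact wordVal_mem_centeredSpan (h.isCenteredWord_smulHead d hl)
  · rw [← Unitization.inr_mul, ← map_mul, ← map_mul]
    exact inr_coe_mem_centeredSpan _

theorem right_sub_eq_zero (j : J) (a : A j) : Ψ' j (a - β j (δ (Ψ' j a))) = 0 := by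
  have := (h.condExp_right' j).apply_self (Ψ' j a)
  simp only [NonUnitalStarAlgHom.comp_apply] at this
  rw [map_sub, this, sub_self]

theorem ι_eq (j : J) (a : A j) :
    (Unitization.inr (ι j a) : Unitization ℂ P)
      = Unitization.inr (ι j (a - β j (δ (Ψ' j a)))) + Unitization.inr (κ (δ (Ψ' j a))) := by
  rw [← Unitization.inr_add, map_sub, h.ι_β, sub_add_cancel]

/-- Left multiplication by a centered letter: if the word begins in the same `A j`, the product of
the two letters is centered again, at the cost of a multiple by `D` of the shortened word. -/
theorem centered_mul_mem_centeredSpan {j : J} {a : A j} (ha : Ψ' j a = 0) {y : Unitization ℂ P}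
    (hy : y ∈ centeredSpan δ ι κ Ψ') :
    Unitization.inr (ι j a) * y ∈ centeredSpan δ ι κ Ψ' := by
  refine mul_mem_centeredSpan_of_generators (fun l hl => ?_) (fun d => ?_) hy
  · by_cases hj : ∀ y ∈ l.head?, j ≠ y.1
    · rw [← wordVal_cons ⟨j, a⟩]
      exact wordVal_mem_centeredSpan (isCenteredWord_cons.mpr ⟨ha, hl, hj⟩)
    · push Not at hj
      obtain ⟨⟨_, a'⟩, hx, rfl⟩ := hj
      obtain ⟨l, rfl⟩ : ∃ l', l = ⟨j, a'⟩ :: l' := ⟨_, List.eq_cons_of_mem_head? hx⟩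
      obtain ⟨-, hl', hne⟩ := isCenteredWord_cons.mp hl
      rw [wordVal_cons, ← mul_assoc, ← Unitization.inr_mul, ← map_mul, h.ι_eq, add_mul]
      refine add_mem ?_ (h.inr_mul_mem_centeredSpan _ (wordVal_mem_centeredSpan hl'))
      rw [← wordVal_cons ⟨j, _⟩]
      exact wordVal_mem_centeredSpan
        (isCenteredWord_cons.mpr ⟨h.right_sub_eq_zero j _, hl', hne⟩)
  · have he : (Unitization.inr (ι j a) * Unitization.inr (κ (δ d)) : Unitization ℂ P)
        = wordVal ι [⟨j, a * β j (δ d)⟩] := by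
      simp [h.ι_β]
    rw [he]
    refine wordVal_mem_centeredSpan (isCenteredWord_cons.mpr ⟨?_, isCenteredWord_nil, by simp⟩)
    have := (h.condExp_right' j).mul_right a d
    simp only [NonUnitalStarAlgHom.comp_apply] at this
    rw [this, ha, zero_mul]

theorem inr_mem_centeredSpan (x : P) : Unitization.inr x ∈ centeredSpan δ ι κ Ψ' := by
  have hx : x ∈ NonUnitalAlgebra.adjoin ℂ (⋃ j, Set.range (ι j)) :=
    h.adjoin_eq_top ▸ NonUnitalAlgebra.mem_top
  have hmul : ∀ y ∈ centeredSpan δ ι κ Ψ', Unitization.inr x * y ∈ centeredSpan δ ι κ Ψ' := by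
    induction hx using NonUnitalAlgebra.adjoin_induction with
    | mem x hx =>
      obtain ⟨j, a, rfl⟩ := Set.mem_iUnion.mp hx
      intro y hy
      rw [h.ι_eq, add_mul]
      exact add_mem (h.centered_mul_mem_centeredSpan (h.right_sub_eq_zero j a) hy)
        (h.inr_mul_mem_centeredSpan _ hy)
    | add x x' _ _ ih ih' =>
      intro y hy
      rw [Unitization.inr_add, add_mul]
      exact add_mem (ih y hy) (ih' y hy)
    | zero => simp
    | mul x x' _ _ ih ih' =>
      intro y hy
      rw [Unitization.inr_mul, mul_assoc]
      exact ih _ (ih' y hy)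
    | smul c x _ ih =>
      intro y hy
      rw [Unitization.inr_smul, smul_mul_assoc]
      exact Submodule.smul_mem _ c (ih y hy)
  simpa using hmul 1 (wordVal_mem_centeredSpan isCenteredWord_nil)

/-- Scalars are absorbed into the first letters, and scalar multiples of the empty word into the
unitization of `B`. -/
theorem exists_eq_sum_wordVal {z : Unitization ℂ P} (hz : z ∈ centeredSpan δ ι κ Ψ') :
    ∃ (α : Type) (_ : Fintype α) (w : α → List (Σ j, A j)) (c : Unitization ℂ B),
      (∀ i, IsCenteredWord Ψ' (w i)) ∧ z = ∑ i, wordVal ι (w i) + Unitization.starMap κ c := by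
  induction hz using Submodule.span_induction with
  | mem z hz =>
    rcases hz with ⟨l, hl, rfl⟩ | ⟨d, rfl⟩
    · exact ⟨Unit, inferInstance, fun _ => l, 0, fun _ => hl, by simp⟩
    · exact ⟨Empty, inferInstance, Empty.elim, Unitization.inr (δ d), nofun, by simp⟩
  | zero => exact ⟨Empty, inferInstance, Empty.elim, 0, nofun, by simp⟩
  | add z z' _ _ ih ih' =>
    obtain ⟨α, _, w, c, hw, rfl⟩ := ih
    obtain ⟨α', _, w', c', hw', rfl⟩ := ih'
    refine ⟨α ⊕ α', inferInstance, Sum.elim w w', c + c', Sum.rec hw hw', ?_⟩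
    simp only [Fintype.sum_sum_type, Sum.elim_inl, Sum.elim_inr, map_add]
    abel
  | smul r z _ ih =>
    obtain ⟨α, _, w, c, hw, rfl⟩ := ih
    have hr (l : List (Σ j, A j)) (hl : IsCenteredWord Ψ' l) :
        ∃ (l' : List (Σ j, A j)) (b : Unitization ℂ B), IsCenteredWord Ψ' l' ∧
          r • wordVal ι l = wordVal ι l' + Unitization.starMap κ b := by
      cases l with
      | nil =>
        refine ⟨[], r • 1 - 1, hl, ?_⟩
        rw [map_sub, map_smul, map_one, wordVal_nil, add_sub_cancel]
      | cons x l =>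
        obtain ⟨hx, hl', hne⟩ := isCenteredWord_cons.mp hl
        refine ⟨⟨x.1, r • x.2⟩ :: l, 0,
          isCenteredWord_cons.mpr ⟨by rw [map_smul, hx, smul_zero], hl', hne⟩, ?_⟩
        simp
    choose w' b hw' hb using fun i => hr (w i) (hw i)
    refine ⟨α, inferInstance, w', ∑ i, b i + r • c, hw', ?_⟩
    rw [smul_add, Finset.smul_sum, map_add, map_sum, map_smul, ← add_assoc,
      ← Finset.sum_add_distrib]
    simp only [hb]

/-- The Schwarz inequality `Φ(x)* Φ(x) ≤ Φ(x* x)`, hence positivity. -/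
theorem isPositiveMap [Fintype J] : IsPositiveMap Φ := by
  intro x
  obtain ⟨α, _, w, c, hw, hx⟩ := h.exists_eq_sum_wordVal (h.inr_mem_centeredSpan x)
  obtain ⟨b, hb, hcov⟩ := h.covariance_sum_wordVal_mem_nonnegInr
    ((∑ i, (w i).length) + 1) w hw fun i => Nat.lt_succ_of_le
      (Finset.single_le_sum (f := fun i => (w i).length) (fun _ _ => Nat.zero_le _)
        (Finset.mem_univ i))
  rw [← h.covariance_sum_add_starMap w hw c, ← hx, covariance, ← Unitization.inr_star,
    ← Unitization.inr_mul, unitalExt_inr, unitalExt_inr, ← Unitization.inr_star,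
    ← Unitization.inr_mul, ← Unitization.inr_sub] at hcov
  rw [sub_eq_iff_eq_add.mp (Unitization.inr_injective hcov)]
  exact add_nonneg hb (star_mul_self_nonneg _)

end IsCFreeExtension

end CFree

/-! ### The amalgamated free product -/

theorem AmalgFreeProduct.adjoin_range_of {J B : Type*} {A : J → Type*}
    [NonUnitalRing B] [StarRing B] [Module ℂ B]
    [∀ j, NonUnitalRing (A j)] [∀ j, StarRing (A j)] [∀ j, Module ℂ (A j)]
    [∀ j, StarModule ℂ (A j)] (β : ∀ j, B →⋆ₙₐ[ℂ] A j) :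
    NonUnitalAlgebra.adjoin ℂ (⋃ j, Set.range (AmalgFreeProduct.of β j)) = ⊤ := by
  refine top_le_iff.mp fun x _ => ?_
  induction x using Quot.ind with | mk t =>
  induction t with
  | of j a =>
    exact NonUnitalAlgebra.subset_adjoin ℂ (Set.mem_iUnion.mpr ⟨j, a, rfl⟩)
  | zero => exact zero_mem (NonUnitalAlgebra.adjoin ℂ (⋃ j, Set.range (AmalgFreeProduct.of β j)))
  | add x y ihx ihy => exact add_mem (ihx trivial) (ihy trivial)
  | neg x ih => exact neg_mem (ih trivial)
  | smul c x ih => exact SMulMemClass.smul_mem c (ih trivial)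
  | mul x y ihx ihy => exact mul_mem (ihx trivial) (ihy trivial)

theorem theorem2p2 {D B : Type*} {A : Fin 2 → Type*}
    [NonUnitalCStarAlgebra D] [PartialOrder D] [StarOrderedRing D]
    [NonUnitalCStarAlgebra B] [PartialOrder B] [StarOrderedRing B]
    [∀ j, NonUnitalRing (A j)] [∀ j, StarRing (A j)] [∀ j, Module ℂ (A j)]
    [∀ j, IsScalarTower ℂ (A j) (A j)] [∀ j, SMulCommClass ℂ (A j) (A j)]
    [∀ j, StarModule ℂ (A j)]
    (δ : D →⋆ₙₐ[ℂ] B) (hδ : Function.Injective δ)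
    (β : ∀ j, B →⋆ₙₐ[ℂ] A j) (hβ : ∀ j, Function.Injective (β j))
    (Φ' : ∀ j, A j →ₗ[ℂ] B) (Ψ' : ∀ j, A j →ₗ[ℂ] D)
    (hΦ' : ∀ j, IsCondExp (β j) (Φ' j)) (hΦ'_pos : ∀ j, IsPositiveMap (Φ' j))
    (hΨ' : ∀ j, IsCondExp ((β j).comp δ) (Ψ' j)) (hΨ'_pos : ∀ j, IsPositiveMap (Ψ' j))
    (Φ : AmalgFreeProduct β →ₗ[ℂ] B) (Ψ : AmalgFreeProduct β →ₗ[ℂ] D)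
    (h : IsCFreeProduct δ β Φ' Ψ' Φ Ψ) :
    IsPositiveMap Φ ∧ IsPositiveMap Ψ := by

  constructor
  · exact IsCFreeExtension.isPositiveMap (δ := δ) (β := β) (Φ' := Φ') (Ψ' := Ψ')
      (ι := AmalgFreeProduct.of β) (κ := (AmalgFreeProduct.of β 0).comp (β 0))
      { ι_β := fun j b => AmalgFreeProduct.of_amalg β j 0 b
        adjoin_eq_top := AmalgFreeProduct.adjoin_range_of β
        condExp_left' := hΦ'
        pos_left' := hΦ'_pos
        condExp_right' := hΨ'
        pos_right' := hΨ'_pos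
        condExp := h.condExp_left 0
        apply_word := h.left_word }
  -- `Ψ` is the case `B = D`, `Φ' = Ψ'`: a centered word has zero letters in `D`, so that the
  -- product of the `Ψ'` of its letters vanishes, like its value under `Ψ`.
  · refine IsCFreeExtension.isPositiveMap (δ := NonUnitalStarAlgHom.id ℂ D)
      (β := fun j => (β j).comp δ) (Φ' := Ψ') (Ψ' := Ψ')
      (ι := AmalgFreeProduct.of β) (κ := (AmalgFreeProduct.of β 0).comp ((β 0).comp δ))
      { ι_β := fun j d => AmalgFreeProduct.of_amalg β j 0 (δ d)
        adjoin_eq_top := AmalgFreeProduct.adjoin_range_of β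
        condExp_left' := hΨ'
        pos_left' := hΨ'_pos
        condExp_right' := hΨ'
        pos_right' := hΨ'_pos
        condExp := h.condExp_right 0
        apply_word := fun x l hl hc => ?_ }
    rw [h.right_word x l hl hc]
    have hx : Ψ' x.1 x.2 = 0 := hc x List.mem_cons_self
    cases l with
    | nil => exact hx.symm
    | cons y l => rw [List.map_cons, wordProd, hx, zero_mul]
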